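/- All graphs are finite and simple. Let $P_k$ be the path on $k$ vertices, $\overline{P_k}$ its complement, and let $\mathcal C_k$ be the class of graphs that contain neither $P_k$ nor $\overline{P_k}$ as an induced subgraph. For every $k$ the following hold. (1) There is a constant $c_k>0$ such that, for every $n\ge 2$, every graph $G\in\mathcal C_k$ on $n$ vertices contains, for some integer $\ell\ge c_k n$, two disjoint vertex sets $X,Y$ with $|X|=|Y|=\ell$ such that either $G$ has no edge between $X$ and $Y$, or every vertex of $X$ is adjacent to every vertex of $Y$. (2) The class $\mathcal C_k$ has the Erdős–Hajnal property: there is a constant $c'_k>0$ such that, for every $n$, every graph in $\mathcal C_k$ on $n$ vertices contains a clique or a stable set of size at least $n^{c'_k}$. -/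

import Mathlib

universe u

namespace PathAntipath

/-- A class of graphs: a property of graphs that is closed under induced subgraphs
(and hence under isomorphism). -/
structure GraphClass where
  Mem : ∀ {V : Type u}, SimpleGraph V → Prop
  hereditary : ∀ {V W : Type u} (G : SimpleGraph V) (H : SimpleGraph W),
    H.IsIndContained G → Mem G → Mem H

/-- The class `C_k` of graphs inducing neither the path `P_k` on `k` vertices nor its
complement. -/
def pathAntipathFree (k : ℕ) : GraphClass.{u} where
  Mem G := ¬ (SimpleGraph.pathGraph k).IsIndContained G ∧
    ¬ (SimpleGraph.pathGraph k)ᶜ.IsIndContained G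
  hereditary _ _ hHG hG := ⟨fun h => hG.1 (h.trans hHG), fun h => hG.2 (h.trans hHG)⟩

/-- `G` contains a complete `ℓ`-bipartite graph: two disjoint sets of `ℓ` vertices each, with
all edges between them (and no condition inside either set). -/
def HasCompleteBipartite {V : Type u} (G : SimpleGraph V) (ℓ : ℕ) : Prop :=
  ∃ X Y : Finset V, Disjoint X Y ∧ X.card = ℓ ∧ Y.card = ℓ ∧ ∀ x ∈ X, ∀ y ∈ Y, G.Adj x y

/-- `G` contains an empty `ℓ`-bipartite graph: two disjoint sets of `ℓ` vertices each, with
no edge between them (and no condition inside either set). -/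
def HasEmptyBipartite {V : Type u} (G : SimpleGraph V) (ℓ : ℕ) : Prop :=
  ∃ X Y : Finset V, Disjoint X Y ∧ X.card = ℓ ∧ Y.card = ℓ ∧ ∀ x ∈ X, ∀ y ∈ Y, ¬ G.Adj x y

/-- The Erdős–Hajnal property: for some `c > 0`, every `n`-vertex graph of the class has a
clique or a stable set of size at least `n ^ c`. -/
def GraphClass.ErdosHajnal (C : GraphClass.{u}) : Prop :=
  ∃ c : ℝ, 0 < c ∧ ∀ (V : Type u) [Fintype V] (G : SimpleGraph V), C.Mem G →
    ∃ S : Finset V, (G.IsClique (S : Set V) ∨ G.IsIndepSet (S : Set V)) ∧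
      (Fintype.card V : ℝ) ^ c ≤ (S.card : ℝ)

end PathAntipath

/-! Excluding one induced subgraph already forces, as in Rödl's theorem, a linear-sized set that is
very sparse in `G` or in `Gᶜ` (`exists_sparse_or_dense`). Excluding both the path and the antipath
makes the two cases symmetric. Deleting vertices of high degree then bounds every degree in the
sparse set.

If that set had no linear-sized empty pair, each large subset would have a component missing few
vertices. An induced path can then be grown in the manner of Gyárfás: discard the neighbourhood of
the current end, keep the big component, and enter it through a single neighbour
(`exists_induced_path_from`). This yields the pairs of (1), inside every set of at least two
vertices (`exists_homogeneous_pair`).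

For (2), recursing into both sides of such a pair makes the product of a stable set's size and a
clique's size polynomially large (`card_le_pow_indep_mul_clique`). -/

namespace PathAntipath

section

open Finset
open scoped Classical

variable {V : Type u}

/-! ### Edge counts and averaging -/

/-- The number of pairs `(a, b) ∈ A × B` that are adjacent in `G`. -/
noncomputable def edgeCount (G : SimpleGraph V) (A B : Finset V) : ℕ :=
  ∑ a ∈ A, #{b ∈ B | G.Adj a b}

theorem edgeCount_comm (G : SimpleGraph V) (A B : Finset V) :
    edgeCount G A B = edgeCount G B A := by
  unfold edgeCount
  have h := Finset.sum_card_bipartiteAbove_eq_sum_card_bipartiteBelow (s := A) (t := B) G.Adj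
  simp only [Finset.bipartiteAbove, Finset.bipartiteBelow] at h
  rw [h]
  simp only [G.adj_comm]

theorem edgeCount_mono (G : SimpleGraph V) {A A' B B' : Finset V} (hA : A ⊆ A') (hB : B ⊆ B') :
    edgeCount G A B ≤ edgeCount G A' B' := by
  unfold edgeCount
  calc _ ≤ ∑ a ∈ A, #{b ∈ B' | G.Adj a b} :=
        sum_le_sum fun a _ => card_le_card (filter_subset_filter _ hB)
    _ ≤ _ := sum_le_sum_of_subset hA

theorem edgeCount_le_mul (G : SimpleGraph V) (A B : Finset V) :
    edgeCount G A B ≤ #A * #B := by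
  unfold edgeCount
  rw [← smul_eq_mul]
  exact sum_le_card_nsmul _ _ _ fun a _ => card_filter_le _ _

theorem edgeCount_union_left (G : SimpleGraph V) {A B : Finset V} (h : Disjoint A B)
    (C : Finset V) : edgeCount G (A ∪ B) C = edgeCount G A C + edgeCount G B C :=
  sum_union h

theorem edgeCount_union_self (G : SimpleGraph V) {A B : Finset V} (h : Disjoint A B) :
    edgeCount G (A ∪ B) (A ∪ B) = edgeCount G A A + edgeCount G B B + 2 * edgeCount G A B := by
  rw [edgeCount_union_left G h, edgeCount_comm G A, edgeCount_comm G B,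
    edgeCount_union_left G h, edgeCount_union_left G h, edgeCount_comm G B A]
  ring

/-- Some subset of a prescribed size has at most its fair share of the total weight. -/
theorem exists_subset_card_eq_sum_le (f : V → ℕ) {m : ℕ} (B : Finset V) (hm : m ≤ #B) :
    ∃ B' ⊆ B, #B' = m ∧ #B * ∑ b ∈ B', f b ≤ m * ∑ b ∈ B, f b := by
  induction B using Finset.strongInduction with
  | H B ih =>
    rcases hm.eq_or_lt with rfl | hlt
    · exact ⟨B, Subset.rfl, rfl, le_rfl⟩
    -- Deleting a heaviest element does not raise the average weight.
    · obtain ⟨x, hx, hmax⟩ := exists_max_image B f (card_pos.1 (by omega))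
      have hc := card_erase_add_one hx
      obtain ⟨B', hB', hcard, hle⟩ := ih (B.erase x) (erase_ssubset hx) (by omega)
      refine ⟨B', hB'.trans (erase_subset _ _), hcard, ?_⟩
      have h1 : ∑ b ∈ B', f b ≤ m * f x := by
        rw [← hcard, ← smul_eq_mul]
        exact sum_le_card_nsmul _ _ _ fun b hb => hmax b (mem_of_mem_erase (hB' hb))
      rw [← hc, ← sum_erase_add B f hx]
      linarith

/-! ### Sparse pairs by greedy embedding -/

/-- Either the graph `H` on `Fin k` embeds into `G` transversally to given large disjoint sets, or
some two of these sets contain a pair of `m`-sets that is sparse in `G` or in its complement. -/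
theorem exists_transversal_or_sparse_pair {q : ℕ} (hq : 0 < q) (k : ℕ) :
    ∃ L : ℕ, ∀ (V : Type u) (G : SimpleGraph V) (H : SimpleGraph (Fin k)) (m : ℕ), 0 < m →
      ∀ W : Fin k → Finset V, Pairwise (fun i j => Disjoint (W i) (W j)) →
      (∀ j, L * m ≤ #(W j)) →
      (∃ f : Fin k → V, (∀ j, f j ∈ W j) ∧ ∀ i j, G.Adj (f i) (f j) ↔ H.Adj i j) ∨
      ∃ F, (F = G ∨ F = Gᶜ) ∧ ∃ i j, ∃ A ⊆ W i, ∃ B ⊆ W j, Disjoint A B ∧ #A = m ∧ #B = m ∧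
        q * edgeCount F A B ≤ m * m := by
  induction k with
  | zero => exact ⟨0, fun V G H m _ W _ _ => .inl ⟨Fin.elim0, fun j => j.elim0, fun j => j.elim0⟩⟩
  | succ k ih =>
    obtain ⟨L, hL⟩ := ih
    -- The term `q * L` survives shrinking each set by a factor `q`; the term `k + 1` keeps `k` bad
    -- sets of fewer than `m` vertices from covering `W 0`.
    refine ⟨q * L + (k + 1), fun V G H m hm W hW hcard => ?_⟩
    -- Being `F j`-adjacent to the image of `0` is exactly what `H` asks of the image of `j.succ`.
    let F : Fin k → SimpleGraph V := fun j => if H.Adj 0 j.succ then G else Gᶜ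
    have hF : ∀ j, F j = G ∨ F j = Gᶜ := fun j => by
      by_cases h : H.Adj 0 j.succ <;> simp [F, h]
    let bad : Fin k → Finset V := fun j =>
      {v ∈ W 0 | q * #{b ∈ W j.succ | (F j).Adj v b} < #(W j.succ)}
    by_cases hbad : ∃ j, m ≤ #(bad j)
    · right
      obtain ⟨j, hj⟩ := hbad
      obtain ⟨A, hA, hAm⟩ := exists_subset_card_eq hj
      have hmW : m ≤ #(W j.succ) := by nlinarith [hcard j.succ, Nat.zero_le (q * L * m)]
      obtain ⟨B, hB, hBm, hle⟩ := exists_subset_card_eq_sum_le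
        (fun b => #{a ∈ A | (F j).Adj b a}) (W j.succ) hmW
      have hAW : A ⊆ W 0 := hA.trans (filter_subset _ _)
      refine ⟨F j, hF j, 0, j.succ, A, hAW, B, hB,
        disjoint_of_subset_left hAW (disjoint_of_subset_right hB (hW (Fin.succ_ne_zero j).symm)),
        hAm, hBm, ?_⟩
      change #(W j.succ) * edgeCount (F j) B A ≤ m * edgeCount (F j) (W j.succ) A at hle
      rw [edgeCount_comm _ B, edgeCount_comm _ (W j.succ)] at hle
      have h1 : q * edgeCount (F j) A (W j.succ) ≤ m * #(W j.succ) := by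
        unfold edgeCount
        rw [mul_sum, ← hAm, ← smul_eq_mul (#A)]
        exact sum_le_card_nsmul _ _ _ fun a ha => (mem_filter.1 (hA ha)).2.le
      have hpos : 0 < #(W j.succ) := by omega
      refine Nat.le_of_mul_le_mul_left ?_ hpos
      calc #(W j.succ) * (q * edgeCount (F j) A B)
          = q * (#(W j.succ) * edgeCount (F j) A B) := by ring
        _ ≤ q * (m * edgeCount (F j) A (W j.succ)) := Nat.mul_le_mul_left _ hle
        _ = m * (q * edgeCount (F j) A (W j.succ)) := by ring
        _ ≤ m * (m * #(W j.succ)) := Nat.mul_le_mul_left _ h1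
        _ = _ := by ring
    · push Not at hbad
      have hgood : ∃ v ∈ W 0, ∀ j, v ∉ bad j := by
        by_contra! hcon
        have hsub : W 0 ⊆ univ.biUnion bad := fun v hv => by
          obtain ⟨j, hj⟩ := hcon v hv
          exact mem_biUnion.2 ⟨j, mem_univ _, hj⟩
        have h1 := (card_le_card hsub).trans
          (card_biUnion_le_card_mul univ bad m fun j _ => (hbad j).le)
        rw [card_univ, Fintype.card_fin] at h1
        nlinarith [hcard 0, Nat.zero_le (q * L * m)]
      obtain ⟨v, hv, hvb⟩ := hgood
      let W' : Fin k → Finset V := fun j => {b ∈ W j.succ | (F j).Adj v b}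
      have hW'sub : ∀ j, W' j ⊆ W j.succ := fun j => filter_subset _ _
      have hW' : ∀ j, L * m ≤ #(W' j) := fun j => by
        have h1 : #(W j.succ) ≤ q * #(W' j) := by
          by_contra! h
          exact hvb j (mem_filter.2 ⟨hv, h⟩)
        refine Nat.le_of_mul_le_mul_left ?_ hq
        nlinarith [hcard j.succ]
      rcases hL V G (H.comap Fin.succ) m hm W' (fun i j hij => disjoint_of_subset_left (hW'sub i)
        (disjoint_of_subset_right (hW'sub j) (hW (by simpa using hij)))) hW' with h | h
      · left
        obtain ⟨f, hf, hadj⟩ := h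
        have h0 : ∀ j, G.Adj v (f j) ↔ H.Adj 0 j.succ := fun j => by
          have h1 := (mem_filter.1 (hf j)).2
          by_cases h : H.Adj 0 j.succ
          · simpa [F, h] using h1
          · have h2 : Gᶜ.Adj v (f j) := by simpa [F, h] using h1
            simp [h, ((SimpleGraph.compl_adj _ _ _).1 h2).2]
        refine ⟨Fin.cons v f, fun j => ?_, fun i j => ?_⟩
        · cases j using Fin.cases with
          | zero => exact hv
          | succ j => exact hW'sub j (hf j)
        · cases i using Fin.cases with
          | zero =>
            cases j using Fin.cases with
            | zero => simp
            | succ j => simpa using h0 j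
          | succ i =>
            cases j using Fin.cases with
            | zero => simpa [G.adj_comm, H.adj_comm] using h0 i
            | succ j => simpa using hadj i j
      · right
        obtain ⟨F', hF', i, j, A, hA, B, hB, h⟩ := h
        exact ⟨F', hF', i.succ, j.succ, A, hA.trans (hW'sub i), B, hB.trans (hW'sub j), h⟩

theorem exists_pairwise_disjoint_subsets (U : Finset V) (k m : ℕ) (h : k * m ≤ #U) :
    ∃ W : Fin k → Finset V, Pairwise (fun i j => Disjoint (W i) (W j)) ∧
      ∀ j, W j ⊆ U ∧ #(W j) = m := by
  induction k generalizing U with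
  | zero => exact ⟨fun _ => ∅, fun i => i.elim0, fun i => i.elim0⟩
  | succ k ih =>
    obtain ⟨A, hA, hAm⟩ := exists_subset_card_eq (s := U) (n := m) (by nlinarith)
    have hc := card_sdiff_of_subset hA
    obtain ⟨W, hW, hWU⟩ := ih (U \ A) (by rw [hc, hAm]; apply Nat.le_sub_of_add_le; linarith)
    have hd : ∀ j, Disjoint A (W j) := fun j =>
      disjoint_of_subset_right (hWU j).1 disjoint_sdiff
    refine ⟨Fin.cons A W, fun i j hij => ?_, fun j => ?_⟩
    · cases i using Fin.cases with
      | zero =>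
        cases j using Fin.cases with
        | zero => exact absurd rfl hij
        | succ j => simpa using hd j
      | succ i =>
        cases j using Fin.cases with
        | zero => simpa using (hd i).symm
        | succ j => simpa using hW (by simpa using hij)
    · cases j using Fin.cases with
      | zero => exact ⟨hA, hAm⟩
      | succ j => exact ⟨(hWU j).1.trans sdiff_subset, (hWU j).2⟩

/-- A large vertex set of an `H`-free graph contains a large pair of sets that is sparse in the
graph or in its complement. -/
theorem exists_sparse_pair {k : ℕ} (H : SimpleGraph (Fin k)) {q : ℕ} (hq : 0 < q) :
    ∃ D : ℕ, ∀ (V : Type u) (G : SimpleGraph V), ¬ H.IsIndContained G →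
      ∀ (m : ℕ) (U : Finset V), D * m ≤ #U →
      ∃ F, (F = G ∨ F = Gᶜ) ∧ ∃ A ⊆ U, ∃ B ⊆ U, Disjoint A B ∧ #A = m ∧ #B = m ∧
        q * edgeCount F A B ≤ m * m := by
  obtain ⟨L, hL⟩ := exists_transversal_or_sparse_pair.{u} hq k
  refine ⟨k * L, fun V G hG m U hU => ?_⟩
  rcases m.eq_zero_or_pos with rfl | hm
  · exact ⟨G, .inl rfl, ∅, empty_subset _, ∅, empty_subset _, by simp [edgeCount]⟩
  obtain ⟨W, hW, hWU⟩ := exists_pairwise_disjoint_subsets U k (L * m) (by rwa [← mul_assoc])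
  rcases hL V G H m hm W hW fun j => (hWU j).2.ge with ⟨f, hf, hadj⟩ | ⟨F, hF, i, j, A, hA, B, hB, h⟩
  · refine absurd ⟨⟨⟨f, fun i j hij => ?_⟩, fun {i j} => hadj i j⟩⟩ hG
    by_contra hne
    exact (disjoint_left.1 (hW hne) (hf i)) (hij ▸ hf j)
  · exact ⟨F, hF, A, hA.trans (hWU i).1, B, hB.trans (hWU j).1, h⟩

/-! ### From sparse pairs to sparse sets -/

/-- Adding the two hypotheses leaves a slack of `2 * (m * m)`. The cross edges, counted twice, use
at most half of it because `q > 2 * K²`, so the slack `m * m` is passed on to the union. -/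
theorem edgeCount_union_bound (F : SimpleGraph V) {A B S T : Finset V} {i m K q : ℕ}
    (hAB : Disjoint A B) (hS : S ⊆ A) (hT : T ⊆ B) (hSc : #S = 2 ^ i * m) (hTc : #T = 2 ^ i * m)
    (hSe : edgeCount F S S + m * m ≤ 2 ^ (i + 1) * (m * m))
    (hTe : edgeCount F T T + m * m ≤ 2 ^ (i + 1) * (m * m))
    (hq : 2 * (K * K) < q) (he : q * edgeCount F A B ≤ (K * m) * (K * m)) :
    #(S ∪ T) = 2 ^ (i + 1) * m ∧
      edgeCount F (S ∪ T) (S ∪ T) + m * m ≤ 2 ^ (i + 1 + 1) * (m * m) := by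
  have hST : Disjoint S T := disjoint_of_subset_left hS (disjoint_of_subset_right hT hAB)
  refine ⟨by rw [card_union_of_disjoint hST, hSc, hTc]; ring, ?_⟩
  have h1 : edgeCount F S T ≤ edgeCount F A B := edgeCount_mono F hS hT
  have h2 : 2 * edgeCount F A B ≤ m * m := by
    refine Nat.le_of_mul_le_mul_left ?_ (by omega : 0 < q)
    calc q * (2 * edgeCount F A B) = 2 * (q * edgeCount F A B) := by ring
      _ ≤ 2 * ((K * m) * (K * m)) := Nat.mul_le_mul_left _ he
      _ = (2 * (K * K)) * (m * m) := by ring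
      _ ≤ _ := Nat.mul_le_mul_right _ hq.le
  rw [edgeCount_union_self F hST, pow_succ 2 (i + 1)]
  linarith

/-- A large vertex set of an `H`-free graph contains a linear-sized set inducing a subgraph of
density at most `2 / 2 ^ i` in the graph or at most `2 / 2 ^ j` in its complement. -/
theorem exists_sparse_or_dense {k : ℕ} (H : SimpleGraph (Fin k)) (i j : ℕ) :
    ∃ D : ℕ, ∀ (V : Type u) (G : SimpleGraph V), ¬ H.IsIndContained G →
      ∀ (m : ℕ) (U : Finset V), D * m ≤ #U →
      (∃ S ⊆ U, #S = 2 ^ i * m ∧ edgeCount G S S + m * m ≤ 2 ^ (i + 1) * (m * m)) ∨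
      (∃ S ⊆ U, #S = 2 ^ j * m ∧ edgeCount Gᶜ S S + m * m ≤ 2 ^ (j + 1) * (m * m)) := by
  have base : ∀ {V : Type u} (F : SimpleGraph V) (m : ℕ) (U : Finset V), 1 * m ≤ #U →
      ∃ S ⊆ U, #S = 2 ^ 0 * m ∧ edgeCount F S S + m * m ≤ 2 ^ (0 + 1) * (m * m) := by
    intro V F m U hU
    obtain ⟨S, hS, hc⟩ := exists_subset_card_eq (s := U) (n := m) (by omega)
    have := edgeCount_le_mul F S S
    rw [hc] at this
    exact ⟨S, hS, by omega, by omega⟩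
  induction i generalizing j with
  | zero => exact ⟨1, fun V G _ m U hU => .inl (base G m U hU)⟩
  | succ i ihi =>
    induction j with
    | zero => exact ⟨1, fun V G _ m U hU => .inr (base Gᶜ m U hU)⟩
    | succ j ihj =>
      -- `D₁` serves levels `(i, j + 1)` and `D₂` serves `(i + 1, j)`. On both sides of a pair
      -- sparse in `G` the first is used, and two sparse outcomes merge into level `i + 1`; a pair
      -- sparse in `Gᶜ` is treated dually.
      obtain ⟨D₁, h₁⟩ := ihi (j + 1)
      obtain ⟨D₂, h₂⟩ := ihj
      obtain ⟨D, hD⟩ := exists_sparse_pair.{u} H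
        (q := 2 * ((D₁ + D₂) * (D₁ + D₂)) + 1) (by omega)
      refine ⟨D * (D₁ + D₂), fun V G hG m U hU => ?_⟩
      obtain ⟨F, hF, A, hA, B, hB, hAB, hAm, hBm, he⟩ :=
        hD V G hG ((D₁ + D₂) * m) U (by rwa [← mul_assoc])
      have hle₁ : D₁ * m ≤ (D₁ + D₂) * m := Nat.mul_le_mul_right _ (by omega)
      have hle₂ : D₂ * m ≤ (D₁ + D₂) * m := Nat.mul_le_mul_right _ (by omega)
      rcases hF with rfl | rfl
      · rcases h₁ V F hG m A (by omega) with ⟨S, hS, hSc, hSe⟩ | ⟨S, hS, h⟩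
        · rcases h₁ V F hG m B (by omega) with ⟨T, hT, hTc, hTe⟩ | ⟨T, hT, h⟩
          · exact .inl ⟨S ∪ T, union_subset (hS.trans hA) (hT.trans hB),
              edgeCount_union_bound F hAB hS hT hSc hTc hSe hTe (Nat.lt_succ_self _) he⟩
          · exact .inr ⟨T, hT.trans hB, h⟩
        · exact .inr ⟨S, hS.trans hA, h⟩
      · rcases h₂ V G hG m A (by omega) with ⟨S, hS, h⟩ | ⟨S, hS, hSc, hSe⟩
        · exact .inl ⟨S, hS.trans hA, h⟩
        · rcases h₂ V G hG m B (by omega) with ⟨T, hT, h⟩ | ⟨T, hT, hTc, hTe⟩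
          · exact .inl ⟨T, hT.trans hB, h⟩
          · exact .inr ⟨S ∪ T, union_subset (hS.trans hA) (hT.trans hB),
              edgeCount_union_bound Gᶜ hAB hS hT hSc hTc hSe hTe (Nat.lt_succ_self _) he⟩

/-! ### Large components and induced paths -/

/-- `C` cannot be split into two nonempty parts with no edge of `G` between them. -/
def IsConnectedSet (G : SimpleGraph V) (C : Finset V) : Prop :=
  ∀ X ⊆ C, X.Nonempty → X ≠ C → ∃ x ∈ X, ∃ y ∈ C \ X, G.Adj x y

/-- `G` has an edge between any two disjoint subsets of `T` with at least `m` vertices each. -/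
def MeetsLargePairs (G : SimpleGraph V) (m : ℕ) (T : Finset V) : Prop :=
  ∀ X ⊆ T, ∀ Y ⊆ T, Disjoint X Y → m ≤ #X → m ≤ #Y → ∃ x ∈ X, ∃ y ∈ Y, G.Adj x y

theorem MeetsLargePairs.mono {G : SimpleGraph V} {m : ℕ} {S T : Finset V}
    (h : MeetsLargePairs G m T) (hST : S ⊆ T) : MeetsLargePairs G m S :=
  fun X hX Y hY => h X (hX.trans hST) Y (hY.trans hST)

/-- Take a smallest union of components of `T` missing fewer than `m` vertices. If it split, each
piece would miss at least `m` vertices by minimality, hence have fewer than `m` itself, leaving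
fewer than `2 * m` in total, which `3 * m ≤ #T` forbids. -/
theorem MeetsLargePairs.exists_component {G : SimpleGraph V} {m : ℕ} {T : Finset V}
    (h : MeetsLargePairs G m T) (hm : 0 < m) (hT : 3 * m ≤ #T) :
    ∃ X ⊆ T, IsConnectedSet G X ∧ #T < #X + m ∧ ∀ x ∈ X, ∀ y ∈ T \ X, ¬ G.Adj x y := by
  let P : Finset (Finset V) := {X ∈ T.powerset | #T < #X + m ∧ ∀ x ∈ X, ∀ y ∈ T \ X, ¬ G.Adj x y}
  have hTP : T ∈ P := by simp +contextual [P, hm]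
  obtain ⟨X, hX, hmin⟩ := exists_min_image P card ⟨T, hTP⟩
  obtain ⟨hXT, hXc, hXadj⟩ : X ⊆ T ∧ #T < #X + m ∧ ∀ x ∈ X, ∀ y ∈ T \ X, ¬ G.Adj x y := by
    simpa [P] using hX
  refine ⟨X, hXT, ?_, hXc, hXadj⟩
  intro Z hZX hZne hZ
  by_contra! hcon
  have small : ∀ Y ⊆ X, Y ≠ X → (∀ x ∈ Y, ∀ y ∈ X \ Y, ¬ G.Adj x y) → #Y < m := by
    intro Y hYX hY hYadj
    have hclosed : ∀ x ∈ Y, ∀ y ∈ T \ Y, ¬ G.Adj x y := by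
      intro x hx y hy
      rw [mem_sdiff] at hy
      by_cases hyX : y ∈ X
      · exact hYadj x hx y (mem_sdiff.2 ⟨hyX, hy.2⟩)
      · exact hXadj x (hYX hx) y (mem_sdiff.2 ⟨hy.1, hyX⟩)
    have hlt : #Y < #X := card_lt_card (hYX.ssubset_of_ne hY)
    have hnot : ¬ #T < #Y + m := fun hc => by
      have := hmin Y (mem_filter.2 ⟨mem_powerset.2 (hYX.trans hXT), hc, hclosed⟩)
      omega
    by_contra! hYm
    obtain ⟨x, hx, y, hy, hadj⟩ := h Y (hYX.trans hXT) (T \ Y) sdiff_subset disjoint_sdiff hYm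
      (by rw [card_sdiff_of_subset (hYX.trans hXT)]; omega)
    exact hclosed x hx y hy hadj
  have h1 := small Z hZX hZ hcon
  have h2 := small (X \ Z) sdiff_subset
    (fun heq => by
      obtain ⟨z, hz⟩ := hZne
      exact (mem_sdiff.1 (heq ▸ hZX hz)).2 hz)
    (fun x hx y hy => by
      rw [mem_sdiff] at hx hy
      have hyZ : y ∈ Z := by
        by_contra hyZ
        exact hy.2 (mem_sdiff.2 ⟨hy.1, hyZ⟩)
      exact fun hadj => hcon y hyZ x (mem_sdiff.2 hx) hadj.symm)
  have h3 := card_sdiff_add_card_eq_card hZX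
  omega

/-- A connected set in a sparse graph with no large empty pair contains a long induced path from
any of its vertices. -/
theorem exists_induced_path_from {G : SimpleGraph V} {d m : ℕ} (hm : 0 < m) (k : ℕ)
    (C : Finset V) (v : V) (hv : v ∈ C) (hC : IsConnectedSet G C) (hmeet : MeetsLargePairs G m C)
    (hdeg : ∀ x ∈ C, #{y ∈ C | G.Adj x y} ≤ d) (hcard : k * (d + 1 + m) + 3 * m ≤ #C) :
    ∃ f : Fin (k + 1) → V, f 0 = v ∧ (∀ i, f i ∈ C) ∧ Function.Injective f ∧
      ∀ i j, G.Adj (f i) (f j) ↔ (SimpleGraph.pathGraph (k + 1)).Adj i j := by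
  induction k generalizing C v with
  | zero =>
    refine ⟨fun _ => v, rfl, fun _ => hv, fun i j _ => Fin.ext (by omega), fun i j => ?_⟩
    have hij : i = j := Fin.ext (by omega)
    simp [hij]
  | succ k ih =>
    -- One step costs `d + 1` vertices for `v` and its neighbours, and fewer than `m` outside the
    -- big component of the rest.
    let T : Finset V := (C.erase v) \ {y ∈ C | G.Adj v y}
    have hTC : T ⊆ C := sdiff_subset.trans (erase_subset _ _)
    have hTcard : #C ≤ #T + (d + 1) := by
      have h1 := le_card_sdiff {y ∈ C | G.Adj v y} (C.erase v)
      have h2 := card_erase_add_one hv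
      have h3 := hdeg v hv
      change _ ≤ #T at h1
      omega
    have hexp : (k + 1) * (d + 1 + m) = k * (d + 1 + m) + (d + 1 + m) := by ring
    obtain ⟨X, hXT, hXconn, hXcard, hXadj⟩ :=
      (hmeet.mono hTC).exists_component hm (by omega)
    have hmemT : ∀ y, y ∈ T ↔ (y ≠ v ∧ y ∈ C) ∧ ¬ G.Adj v y := fun y => by
      simp only [T, mem_sdiff, mem_erase, mem_filter]
      tauto
    have hXne : X.Nonempty := card_pos.1 (by omega)
    have hvX : v ∉ X := fun h => ((hmemT v).1 (hXT h)).1.1 rfl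
    -- The edge leaving `X` must end at a neighbour `u` of `v`, since `X` is closed in `T` and
    -- misses the neighbours of `v`. So `u` is the only neighbour of `v` in `insert u X`.
    obtain ⟨x, hx, u, hu, hxu⟩ := hC X (hXT.trans hTC) hXne fun h => hvX (h ▸ hv)
    obtain ⟨huC, huX⟩ := mem_sdiff.1 hu
    have huT : u ∉ T := fun h => hXadj x hx u (mem_sdiff.2 ⟨h, huX⟩) hxu
    have huv : u ≠ v := by
      rintro rfl
      exact ((hmemT x).1 (hXT hx)).2 hxu.symm
    have hvu : G.Adj v u := by
      by_contra h
      exact huT ((hmemT u).2 ⟨⟨huv, huC⟩, h⟩)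
    have hsub : insert u X ⊆ C := insert_subset huC (hXT.trans hTC)
    have hconn : IsConnectedSet G (insert u X) := by
      intro Z hZ hZne hZX
      by_cases huZ : u ∈ Z
      · by_cases hxZ : x ∈ Z
        · obtain ⟨z, hz⟩ : (X \ Z).Nonempty := by
            rw [nonempty_iff_ne_empty, Ne, sdiff_eq_empty_iff_subset]
            exact fun h => hZX (hZ.antisymm (insert_subset huZ h))
          by_cases hXZ : X ∩ Z = X
          · exact absurd (hXZ ▸ (mem_sdiff.1 hz).1) fun h => (mem_sdiff.1 hz).2 (mem_inter.1 h).2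
          · obtain ⟨a, ha, b, hb, hab⟩ :=
              hXconn (X ∩ Z) inter_subset_left ⟨x, mem_inter.2 ⟨hx, hxZ⟩⟩ hXZ
            rw [mem_inter] at ha
            rw [mem_sdiff, mem_inter] at hb
            exact ⟨a, ha.2, b, mem_sdiff.2 ⟨mem_insert_of_mem hb.1, fun h => hb.2 ⟨hb.1, h⟩⟩, hab⟩
        · exact ⟨u, huZ, x, mem_sdiff.2 ⟨mem_insert_of_mem hx, hxZ⟩, hxu.symm⟩
      · have hZX' : Z ⊆ X := fun z hz => (mem_insert.1 (hZ hz)).resolve_left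
          fun h => huZ (h ▸ hz)
        by_cases hXZ : Z = X
        · exact ⟨x, hXZ ▸ hx, u, mem_sdiff.2 ⟨mem_insert_self _ _, huZ⟩, hxu⟩
        · obtain ⟨a, ha, b, hb, hab⟩ := hXconn Z hZX' hZne hXZ
          rw [mem_sdiff] at hb
          exact ⟨a, ha, b, mem_sdiff.2 ⟨mem_insert_of_mem hb.1, hb.2⟩, hab⟩
    obtain ⟨f, hf0, hfmem, hfinj, hfadj⟩ := ih (insert u X) u (mem_insert_self _ _) hconn
      (hmeet.mono hsub)
      (fun y hy => (card_le_card (filter_subset_filter _ hsub)).trans (hdeg y (hsub hy)))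
      (by rw [card_insert_of_notMem huX]; omega)
    have hvf : ∀ i, G.Adj v (f i) ↔ i = 0 := fun i => by
      constructor
      · intro h
        rcases mem_insert.1 (hfmem i) with h1 | h1
        · exact hfinj (h1.trans hf0.symm)
        · exact absurd h ((hmemT _).1 (hXT h1)).2
      · rintro rfl
        rwa [hf0]
    refine ⟨Fin.cons v f, rfl, fun i => ?_, Fin.cons_injective_iff.2 ⟨?_, hfinj⟩, fun i j => ?_⟩
    · cases i using Fin.cases with
      | zero => exact hv
      | succ i => exact hsub (hfmem i)
    · rintro ⟨i, hi⟩
      rcases mem_insert.1 (hfmem i) with h1 | h1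
      · exact huv (h1.symm.trans hi)
      · exact hvX (hi ▸ h1)
    · cases i using Fin.cases with
      | zero =>
        cases j using Fin.cases with
        | zero => simp
        | succ j =>
          simp only [Fin.cons_zero, Fin.cons_succ, hvf, SimpleGraph.pathGraph_adj, Fin.ext_iff,
            Fin.val_zero, Fin.val_succ]
          omega
      | succ i =>
        cases j using Fin.cases with
        | zero =>
          simp only [Fin.cons_zero, Fin.cons_succ, G.adj_comm _ v, hvf, SimpleGraph.pathGraph_adj,
            Fin.ext_iff, Fin.val_zero, Fin.val_succ]
          omega
        | succ j => simp [hfadj, SimpleGraph.pathGraph_adj]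

/-- A set of bounded degree in a graph without an induced path on `k + 1` vertices contains an
empty pair. -/
theorem exists_empty_pair {G : SimpleGraph V} {k m : ℕ} (hm : 0 < m)
    (hG : ¬ (SimpleGraph.pathGraph (k + 1)).IsIndContained G) (S : Finset V)
    (hdeg : ∀ x ∈ S, #{y ∈ S | G.Adj x y} ≤ 4 * m) (hcard : (6 * k + 4) * m ≤ #S) :
    ∃ X ⊆ S, ∃ Y ⊆ S, Disjoint X Y ∧ #X = m ∧ #Y = m ∧ ∀ x ∈ X, ∀ y ∈ Y, ¬ G.Adj x y := by
  by_contra! hcon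
  have hmeet : MeetsLargePairs G m S := by
    intro X hX Y hY hXY hXm hYm
    obtain ⟨X', hX', hX'm⟩ := exists_subset_card_eq hXm
    obtain ⟨Y', hY', hY'm⟩ := exists_subset_card_eq hYm
    obtain ⟨x, hx, y, hy, h⟩ := hcon X' (hX'.trans hX) Y' (hY'.trans hY)
      (disjoint_of_subset_left hX' (disjoint_of_subset_right hY' hXY)) hX'm hY'm
    exact ⟨x, hX' hx, y, hY' hy, h⟩
  obtain ⟨C, hCS, hC, hCcard, -⟩ := hmeet.exists_component hm (by nlinarith)
  obtain ⟨v, hv⟩ : C.Nonempty := card_pos.1 (by nlinarith)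
  -- With `d = 4 * m`, each path step costs `5 * m + 1 ≤ 6 * m`; the remaining `4 * m` covers the
  -- final `3 * m` and the loss in passing to `C`.
  obtain ⟨f, -, -, hf, hadj⟩ := exists_induced_path_from hm k C v hv hC (hmeet.mono hCS)
    (fun x hx => (card_le_card (filter_subset_filter _ hCS)).trans (hdeg x (hCS hx)))
    (by nlinarith [Nat.mul_le_mul_left k hm])
  exact hG ⟨⟨⟨f, hf⟩, fun {i j} => hadj i j⟩⟩

/-! ### Linear-sized homogeneous pairs -/

/-- By Markov's inequality at most half of `S` has degree above `4 * m`. -/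
theorem exists_subset_degree_le (F : SimpleGraph V) {i m : ℕ} (hm : 0 < m) {S : Finset V}
    (hS : #S = 2 ^ (i + 1) * m) (he : edgeCount F S S + m * m ≤ 2 ^ (i + 1 + 1) * (m * m)) :
    ∃ T ⊆ S, 2 ^ i * m ≤ #T ∧ ∀ x ∈ T, #{y ∈ T | F.Adj x y} ≤ 4 * m := by
  let T : Finset V := {x ∈ S | #{y ∈ S | F.Adj x y} ≤ 4 * m}
  let B : Finset V := {x ∈ S | ¬ #{y ∈ S | F.Adj x y} ≤ 4 * m}
  have hTB : #T + #B = #S := card_filter_add_card_filter_not _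
  have hB : #B * (4 * m) ≤ edgeCount F S S := by
    rw [← smul_eq_mul]
    calc _ ≤ ∑ x ∈ B, #{y ∈ S | F.Adj x y} :=
          card_nsmul_le_sum _ _ _ fun x hx => (not_le.1 (mem_filter.1 hx).2).le
      _ ≤ _ := sum_le_sum_of_subset (filter_subset _ _)
  have hB' : #B ≤ 2 ^ i * m := by
    refine Nat.le_of_mul_le_mul_left ?_ (by omega : 0 < 4 * m)
    calc 4 * m * #B = #B * (4 * m) := by ring
      _ ≤ 2 ^ (i + 1 + 1) * (m * m) := by omega
      _ = _ := by ring
  refine ⟨T, filter_subset _ _, ?_, fun x hx => ?_⟩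
  · rw [pow_succ] at hS
    linarith
  · exact (card_le_card (filter_subset_filter _ (filter_subset _ _))).trans (mem_filter.1 hx).2

/-- Every set of at least two vertices in a graph without an induced path or antipath on `k`
vertices contains an empty or complete pair of linear size. -/
theorem exists_homogeneous_pair (k : ℕ) :
    ∃ D : ℕ, 0 < D ∧ ∀ (V : Type u) (G : SimpleGraph V), (pathAntipathFree.{u} k).Mem G →
      ∀ U : Finset V, 2 ≤ #U → ∃ F, (F = G ∨ F = Gᶜ) ∧ ∃ X ⊆ U, ∃ Y ⊆ U, Disjoint X Y ∧
        #X = #Y ∧ #U ≤ D * #X ∧ ∀ x ∈ X, ∀ y ∈ Y, ¬ F.Adj x y := by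
  rcases k with _ | k
  -- The empty path embeds in every graph, so the class is empty.
  · refine ⟨1, one_pos, fun V G hG => ?_⟩
    exact absurd ⟨⟨⟨Fin.elim0, fun i => i.elim0⟩, fun {i} => i.elim0⟩⟩ hG.1
  -- The extra `1` in the exponent pays for halving; then `2 ^ (6 * k + 4)` exceeds the `6 * k + 4`
  -- needed by `exists_empty_pair`.
  obtain ⟨D, hD⟩ := exists_sparse_or_dense.{u} (SimpleGraph.pathGraph (k + 1))
    (6 * k + 4 + 1) (6 * k + 4 + 1)
  -- With `m = #U / (D + 1)`, the factor `2` absorbs the rounding when `m ≥ 1`, and when `m = 0` two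
  -- single vertices suffice.
  refine ⟨2 * (D + 1), by omega, fun V G hG U hU => ?_⟩
  have key : ∃ F, (F = G ∨ F = Gᶜ) ∧ ¬ (SimpleGraph.pathGraph (k + 1)).IsIndContained F ∧
      (∃ S ⊆ U, #S = 2 ^ (6 * k + 4 + 1) * (#U / (D + 1)) ∧
        edgeCount F S S + #U / (D + 1) * (#U / (D + 1)) ≤
          2 ^ (6 * k + 4 + 1 + 1) * (#U / (D + 1) * (#U / (D + 1)))) := by
    have h1 := Nat.mul_div_le (#U) (D + 1)
    rcases hD V G hG.1 (#U / (D + 1)) U (by linarith [Nat.zero_le (#U / (D + 1))]) with h | h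
    · exact ⟨G, .inl rfl, hG.1, h⟩
    · refine ⟨Gᶜ, .inr rfl, ?_, h⟩
      rintro ⟨f⟩
      refine hG.2 ⟨⟨f.toEmbedding, fun {i j} => ?_⟩⟩
      have h2 := f.map_rel_iff (a := i) (b := j)
      have h3 : f i = f j ↔ i = j := f.injective.eq_iff
      simp only [SimpleGraph.compl_adj] at h2 ⊢
      change G.Adj (f i) (f j) ↔ _
      change f i ≠ f j ∧ ¬ G.Adj (f i) (f j) ↔ _ at h2
      by_cases hij : i = j
      · subst hij
        simp
      · simp only [ne_eq, h3, hij, not_false_eq_true, true_and] at h2 ⊢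
        rw [← h2, not_not]
  obtain ⟨F, hF, hFfree, hS⟩ := key
  have hlt := Nat.lt_mul_div_succ (#U) (Nat.succ_pos D)
  rcases Nat.eq_zero_or_pos (#U / (D + 1)) with h0 | hpos
  · obtain ⟨x, hx, y, hy, hxy⟩ := one_lt_card.1 hU
    have hsmall : #U ≤ 2 * (D + 1) := by
      simp only [Nat.succ_eq_add_one, h0] at hlt
      omega
    by_cases hadj : G.Adj x y
    · exact ⟨Gᶜ, .inr rfl, {x}, by simpa, {y}, by simpa, by simpa, by simp, by simpa, by simp [hadj]⟩
    · exact ⟨G, .inl rfl, {x}, by simpa, {y}, by simpa, by simpa, by simp, by simpa, by simpa⟩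
  · obtain ⟨S, hSU, hSc, hSe⟩ := hS
    obtain ⟨T, hTS, hTc, hTd⟩ := exists_subset_degree_le F hpos hSc hSe
    obtain ⟨X, hX, Y, hY, hXY, hXm, hYm, hno⟩ := exists_empty_pair hpos hFfree T hTd
      ((Nat.mul_le_mul_right _ Nat.lt_two_pow_self.le).trans hTc)
    refine ⟨F, hF, X, hX.trans (hTS.trans hSU), Y, hY.trans (hTS.trans hSU), hXY,
      hXm.trans hYm.symm, ?_, hno⟩
    rw [hXm]
    simp only [Nat.succ_eq_add_one] at hlt
    nlinarith

/-! ### The Erdős–Hajnal property -/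

/-- Linear-sized empty or complete pairs yield, by induction, a stable set and a clique whose sizes
have a polynomially large product. -/
theorem card_le_pow_indep_mul_clique (G : SimpleGraph V) {D p : ℕ} (hD : D ≤ 2 ^ p)
    (h : ∀ U : Finset V, 2 ≤ #U → ∃ F, (F = G ∨ F = Gᶜ) ∧ ∃ X ⊆ U, ∃ Y ⊆ U, Disjoint X Y ∧
      #X = #Y ∧ #U ≤ D * #X ∧ ∀ x ∈ X, ∀ y ∈ Y, ¬ F.Adj x y) (U : Finset V) :
    ∃ A ⊆ U, ∃ B ⊆ U, G.IsIndepSet (A : Set V) ∧ G.IsClique (B : Set V) ∧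
      #U ≤ (#A * #B) ^ p := by
  induction U using Finset.strongInduction with
  | H U ih =>
    rcases lt_or_ge (#U) 2 with hU | hU
    · refine ⟨U, Subset.rfl, U, Subset.rfl, ?_, ?_, ?_⟩
      · exact Set.Subsingleton.pairwise (card_le_one_iff_subsingleton.1 (by omega)) _
      · exact Set.Subsingleton.pairwise (card_le_one_iff_subsingleton.1 (by omega)) _
      · interval_cases #U <;> simp
    obtain ⟨F, hF, X, hX, Y, hY, hXY, hc, hle, hno⟩ := h U hU
    have hXpos : 0 < #X := Nat.pos_of_ne_zero fun h0 => by rw [h0] at hle; omega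
    have hunion := card_le_card (union_subset hX hY)
    rw [card_union_of_disjoint hXY] at hunion
    have hXU : X ⊂ U := hX.ssubset_of_ne (by rintro rfl; omega)
    have hYU : Y ⊂ U := hY.ssubset_of_ne (by rintro rfl; omega)
    obtain ⟨A₁, hA₁, B₁, hB₁, hi₁, hq₁, h₁⟩ := ih X hXU
    obtain ⟨A₂, hA₂, B₂, hB₂, hi₂, hq₂, h₂⟩ := ih Y hYU
    -- Uniting the sets of one kind and keeping the larger of the other gives a product at least the
    -- sum of the two products, hence twice the smaller; the factor `2 ^ p` pays for `D`.
    have bound : ∀ P : ℕ, #A₁ * #B₁ + #A₂ * #B₂ ≤ P → #U ≤ P ^ p := by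
      intro P hP
      have hmin : #X ≤ (min (#A₁ * #B₁) (#A₂ * #B₂)) ^ p := by
        rcases min_choice (#A₁ * #B₁) (#A₂ * #B₂) with h | h <;> rw [h]
        · exact h₁
        · exact hc ▸ h₂
      calc #U ≤ D * #X := hle
        _ ≤ 2 ^ p * (min (#A₁ * #B₁) (#A₂ * #B₂)) ^ p := Nat.mul_le_mul hD hmin
        _ = (2 * min (#A₁ * #B₁) (#A₂ * #B₂)) ^ p := (mul_pow _ _ _).symm
        _ ≤ P ^ p := Nat.pow_le_pow_left (by omega) _
    rcases hF with rfl | rfl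
    · have hd : Disjoint A₁ A₂ := disjoint_of_subset_left hA₁ (disjoint_of_subset_right hA₂ hXY)
      have hind : F.IsIndepSet ((A₁ ∪ A₂ : Finset V) : Set V) := by
        rw [coe_union]
        refine Set.pairwise_union.2 ⟨hi₁, hi₂, fun a ha b hb _ => ?_⟩
        have := hno a (hA₁ ha) b (hA₂ hb)
        exact ⟨this, fun h => this h.symm⟩
      have hAU : A₁ ∪ A₂ ⊆ U := union_subset (hA₁.trans hX) (hA₂.trans hY)
      rcases le_total (#B₁) (#B₂) with hB | hB
      · refine ⟨A₁ ∪ A₂, hAU, B₂, hB₂.trans hY, hind, hq₂, bound _ ?_⟩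
        rw [card_union_of_disjoint hd]
        nlinarith
      · refine ⟨A₁ ∪ A₂, hAU, B₁, hB₁.trans hX, hind, hq₁, bound _ ?_⟩
        rw [card_union_of_disjoint hd]
        nlinarith
    · have hd : Disjoint B₁ B₂ := disjoint_of_subset_left hB₁ (disjoint_of_subset_right hB₂ hXY)
      have hcl : G.IsClique ((B₁ ∪ B₂ : Finset V) : Set V) := by
        rw [coe_union]
        refine Set.pairwise_union.2 ⟨hq₁, hq₂, fun a ha b hb hab => ?_⟩
        have := hno a (hB₁ ha) b (hB₂ hb)
        rw [SimpleGraph.compl_adj, not_and, not_not] at this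
        exact ⟨this hab, (this hab).symm⟩
      have hBU : B₁ ∪ B₂ ⊆ U := union_subset (hB₁.trans hX) (hB₂.trans hY)
      rcases le_total (#A₁) (#A₂) with hA | hA
      · refine ⟨A₂, hA₂.trans hY, B₁ ∪ B₂, hBU, hi₂, hcl, bound _ ?_⟩
        rw [card_union_of_disjoint hd]
        nlinarith
      · refine ⟨A₁, hA₁.trans hX, B₁ ∪ B₂, hBU, hi₁, hcl, bound _ ?_⟩
        rw [card_union_of_disjoint hd]
        nlinarith

/-- The larger of the stable set and the clique has size at least the square root of the product;
since `D ≤ 2 ^ D`, one may take `p = D`, whence the exponent `1 / (2 * D)`. -/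
theorem erdosHajnal_pathAntipathFree (k : ℕ) : (pathAntipathFree.{u} k).ErdosHajnal := by
  obtain ⟨D, hD0, hD⟩ := exists_homogeneous_pair.{u} k
  refine ⟨((2 * D : ℕ) : ℝ)⁻¹, by positivity, fun V _ G hG => ?_⟩
  obtain ⟨A, -, B, -, hA, hB, hle⟩ := card_le_pow_indep_mul_clique G
    (Nat.lt_two_pow_self (n := D)).le (hD V G hG) univ
  have root : ∀ M : ℕ, #A * #B ≤ M * M →
      (Fintype.card V : ℝ) ^ ((2 * D : ℕ) : ℝ)⁻¹ ≤ (M : ℝ) := by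
    intro M hM
    have h1 : Fintype.card V ≤ M ^ (2 * D) := by
      rw [pow_mul, sq]
      exact hle.trans (Nat.pow_le_pow_left hM _)
    calc (Fintype.card V : ℝ) ^ ((2 * D : ℕ) : ℝ)⁻¹
        ≤ ((M : ℝ) ^ (2 * D)) ^ ((2 * D : ℕ) : ℝ)⁻¹ :=
          Real.rpow_le_rpow (by positivity) (by exact_mod_cast h1) (by positivity)
      _ = M := Real.pow_rpow_inv_natCast (by positivity) (by omega)
  rcases le_total (#A) (#B) with h | h
  · exact ⟨B, .inl hB, root _ (Nat.mul_le_mul_right _ h)⟩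
  · exact ⟨A, .inr hA, root _ (Nat.mul_le_mul_left _ h)⟩

end

end PathAntipath

theorem theorem4 (k : ℕ) :
    (∃ c : ℝ, 0 < c ∧ ∀ (V : Type u) [Fintype V] (G : SimpleGraph V), 2 ≤ Fintype.card V →
      (PathAntipath.pathAntipathFree.{u} k).Mem G →
        ∃ ℓ : ℕ, c * (Fintype.card V : ℝ) ≤ (ℓ : ℝ) ∧
          (PathAntipath.HasEmptyBipartite G ℓ ∨ PathAntipath.HasCompleteBipartite G ℓ)) ∧
    (PathAntipath.pathAntipathFree.{u} k).ErdosHajnal := by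
  refine ⟨?_, PathAntipath.erdosHajnal_pathAntipathFree k⟩
  obtain ⟨D, hD0, hD⟩ := PathAntipath.exists_homogeneous_pair.{u} k
  have hDpos : (0 : ℝ) < D := by exact_mod_cast hD0
  refine ⟨(D : ℝ)⁻¹, by positivity, fun V _ G hV hG => ?_⟩
  obtain ⟨F, hF, X, -, Y, -, hXY, hc, hle, hno⟩ := hD V G hG Finset.univ hV
  refine ⟨X.card, ?_, ?_⟩
  · rw [inv_mul_le_iff₀ hDpos]
    exact_mod_cast hle
  · rcases hF with rfl | rfl
    · exact .inl ⟨X, Y, hXY, rfl, hc.symm, hno⟩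
    · refine .inr ⟨X, Y, hXY, rfl, hc.symm, fun x hx y hy => ?_⟩
      have h := hno x hx y hy
      rw [SimpleGraph.compl_adj, not_and, not_not] at h
      exact h fun hxy => Finset.disjoint_left.1 hXY hx (hxy ▸ hy)
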